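/- Let $\mathbb{F}_q$ be the finite field with $q$ elements. Let $k,n,l,h$ be integers with $l\ge 0$, $2\le k\le \frac{n-2l-1}{2}$ and $1\le h\le k-1$, and suppose $n\mid q-1$. Let $\lambda\in\mathbb{F}_q^{*}$ have multiplicative order dividing $\frac{q-1}{n}$, and let $\alpha_1,\dots,\alpha_n\in\mathbb{F}_q$ be all the roots of $x^n-\lambda$, i.e. $\{\alpha_1,\dots,\alpha_n\}$ is the set of roots of $x^n-\lambda$ in $\mathbb{F}_q$. Let $\boldsymbol{v}=(v_1,\dots,v_n)$ with $v_i\in\{1,-1\}$ for $k\le i\le n$ and $v_i\in\mathbb{F}_q\setminus\{-1,0,1\}$ for $1\le i\le k-1$, and let $\eta_0,\dots,\eta_l\in\mathbb{F}_q$. With $\mathcal{L}=\{0,1,\dots,l\}$, let $\mathcal{C}_h$ be the $(\mathcal{L},\{h\})$-twisted generalized Reed-Solomon (TGRS) code $$\mathcal{C}_h=\Big\{\big(v_1f(\alpha_1),\dots,v_nf(\alpha_n)\big)\ :\ f(x)=\sum_{i=0}^{k-1}f_ix^i+f_h\sum_{t=0}^{l}\eta_t x^{k+t},\ f_0,\dots,f_{k-1}\in\mathbb{F}_q\Big\}\subseteq\mathbb{F}_q^n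 .$$ Let $r_{h-1}$ be the coefficient of $x^{h-1}$ in the remainder of $q(x)=x^{h-1}+\sum_{t=0}^{l}\eta_t x^{k+t-1}$ on division by $g(x)=\prod_{i=1}^{k-1}(x-\alpha_i)$. If $r_{h-1}\neq 0$, then $\alpha_1,\dots,\alpha_n$ are pairwise distinct (so that $\mathcal{C}_h$ is indeed a TGRS code) and $\mathcal{C}_h$ is a (Euclidean) linear complementary dual (LCD) code, that is, $\mathcal{C}_h\cap\mathcal{C}_h^{\perp}=\{\boldsymbol 0\}$, where $\mathcal{C}_h^{\perp}=\{x\in\mathbb{F}_q^n:\sum_i x_ic_i=0\text{ for all }c\in\mathcal{C}_h\}$. -/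

import Mathlib

noncomputable section

/-- The twisted polynomial with coefficients `f₀, …, f_{k-1}`, hook `h`, and twists `η₀, …, η_l`:
`∑_{i<k} fᵢ xⁱ + f_h ∑_{t=0}^{l} η_t x^{k+t}`. -/
def twistedPoly {F : Type*} [Field F] {k l : ℕ} (h : Fin k) (η : Fin (l + 1) → F)
    (f : Fin k → F) : Polynomial F :=
  (∑ i : Fin k, Polynomial.C (f i) * Polynomial.X ^ (i : ℕ)) +
    Polynomial.C (f h) *
      ∑ t : Fin (l + 1), Polynomial.C (η t) * Polynomial.X ^ (k + (t : ℕ))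

/-- The code `C_h = {(v₁ f(α₁), …, vₙ f(αₙ)) : f ∈ F(L, {h}, η)}` with `L = {0, …, l}`. -/
def tgrsCode {F : Type*} [Field F] {n k l : ℕ} (α v : Fin n → F) (h : Fin k)
    (η : Fin (l + 1) → F) : Submodule F (Fin n → F) where
  carrier := {c | ∃ f : Fin k → F, c = fun i => v i * (twistedPoly h η f).eval (α i)}
  zero_mem' := ⟨0, by funext i; simp [twistedPoly]⟩
  add_mem' := by
    rintro _ _ ⟨f, rfl⟩ ⟨g, rfl⟩
    refine ⟨f + g, ?_⟩
    funext i
    simp only [twistedPoly, Pi.add_apply, Polynomial.eval_add, Polynomial.eval_mul,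
      Polynomial.eval_C, Polynomial.eval_finsetSum, add_mul, Finset.sum_add_distrib]
    ring
  smul_mem' := by
    rintro a _ ⟨f, rfl⟩
    refine ⟨a • f, ?_⟩
    funext i
    simp only [twistedPoly, Pi.smul_apply, smul_eq_mul, Polynomial.eval_add, Polynomial.eval_mul,
      Polynomial.eval_C, Polynomial.eval_finsetSum, mul_assoc, ← Finset.mul_sum]
    ring

/-- The Euclidean dual code `C^⊥`. -/
def euclideanDual {F : Type*} [Field F] {n : ℕ} (C : Submodule F (Fin n → F)) :
    Submodule F (Fin n → F) where
  carrier := {x | ∀ c ∈ C, x ⬝ᵥ c = 0}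
  zero_mem' := fun c _ => zero_dotProduct c
  add_mem' := by
    intro x y hx hy c hc
    rw [add_dotProduct, hx c hc, hy c hc, add_zero]
  smul_mem' := by
    intro a x hx c hc
    rw [smul_dotProduct, hx c hc, smul_zero]

/-- The Euclidean hull `C ∩ C^⊥`. -/
def euclideanHull {F : Type*} [Field F] {n : ℕ} (C : Submodule F (Fin n → F)) :
    Submodule F (Fin n → F) :=
  C ⊓ euclideanDual C

/-- `C` is a (Euclidean) linear complementary dual code. -/
def IsLCD {F : Type*} [Field F] {n : ℕ} (C : Submodule F (Fin n → F)) : Prop :=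
  euclideanHull C = ⊥

/-- `q(x) = x^{h-1} + ∑_{t=0}^{l} η_t x^{k+t-1}` (used for `1 ≤ h < k`). -/
def hookPoly {F : Type*} [Field F] {k l : ℕ} (h : Fin k) (η : Fin (l + 1) → F) : Polynomial F :=
  Polynomial.X ^ ((h : ℕ) - 1) +
    ∑ t : Fin (l + 1), Polynomial.C (η t) * Polynomial.X ^ (k + (t : ℕ) - 1)

/-- `g(x) = ∏_{i=1}^{k-1} (x - αᵢ)`. The point `αᵢ` with 1-based index `i` is the value of `α`
at the 0-based index `i - 1`. -/
def headPoly {F : Type*} [Field F] {n : ℕ} (k : ℕ) (α : Fin n → F) : Polynomial F :=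
  ∏ i ∈ Finset.univ.filter (fun i : Fin n => (i : ℕ) + 1 ≤ k - 1), (Polynomial.X - Polynomial.C (α i))

end

open Polynomial

/-! ### Power sums over the roots of `X ^ n - a`. -/

section RootsOfXPowSub

variable {F : Type*} [Field F] {n : ℕ}

/-! For twisted polynomials `f`, `g` the product has degree at most `2(k+l) < n`, so its sum over
all `α i` is `n f(0) g(0)` (`sum_eval_of_range_eq_roots`). As `v i ^ 2 = 1` on the tail,
orthogonality becomes `n f(0) g(0) + ∑ (v i ^ 2 - 1) f(α i) g(α i) = 0`, summed over the `k - 1`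
head points: a diagonal form with nonzero weights in the values at `0` and those points. The
remainder condition makes evaluation at these `k` points bijective (`headEval_surjective`), so `g`
can isolate each value of `f`; all vanish, and `f = 0`. -/

theorem exists_isPrimitiveRoot_of_dvd_card_sub_one [Fintype F] (hn : n ∣ Fintype.card F - 1) :
    ∃ ζ : F, IsPrimitiveRoot ζ n := by
  classical
  obtain ⟨g, hg⟩ := IsCyclic.exists_generator (α := Fˣ)
  have hord : orderOf g = Fintype.card F - 1 := by
    rw [orderOf_eq_card_of_forall_mem_zpowers hg, Nat.card_eq_fintype_card, Fintype.card_units]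
  have hpos : 0 < Fintype.card F - 1 := Nat.sub_pos_of_lt Fintype.one_lt_card
  obtain ⟨m, hm⟩ := hn
  refine ⟨((g ^ m : Fˣ) : F), ?_⟩
  rw [IsPrimitiveRoot.coe_units_iff]
  exact (IsPrimitiveRoot.iff_orderOf.mpr hord).pow hpos (by rw [hm, mul_comm])

/-- With `q - 1 = n m` and `a = g ^ e` for a generator `g`, `a ^ m = 1` forces `n m ∣ e m`, hence `n
∣ e`. -/
theorem exists_pow_eq_of_orderOf_dvd [Fintype F] (hn : n ∣ Fintype.card F - 1) {a : F} (ha : a ≠ 0)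
    (hord : orderOf a ∣ (Fintype.card F - 1) / n) : ∃ b : F, b ^ n = a := by
  classical
  obtain ⟨g, hg⟩ := IsCyclic.exists_generator (α := Fˣ)
  have hgord : orderOf g = Fintype.card F - 1 := by
    rw [orderOf_eq_card_of_forall_mem_zpowers hg, Nat.card_eq_fintype_card, Fintype.card_units]
  have hpos : 0 < Fintype.card F - 1 := Nat.sub_pos_of_lt Fintype.one_lt_card
  obtain ⟨m, hm⟩ := hn
  have hn0 : 0 < n := Nat.pos_of_ne_zero (by rintro rfl; simp at hm; omega)
  have hm0 : 0 < m := Nat.pos_of_ne_zero (by rintro rfl; simp at hm; omega)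
  rw [hm, Nat.mul_div_cancel_left _ hn0] at hord
  obtain ⟨e, he⟩ := (mem_powers_iff_mem_zpowers.mpr (hg (Units.mk0 a ha)))
  have he' : g ^ e = Units.mk0 a ha := he
  have hpow : g ^ (e * m) = 1 := by
    rw [pow_mul, he']
    ext
    simpa using orderOf_dvd_iff_pow_eq_one.mp hord
  have hdvd : n ∣ e := by
    have := orderOf_dvd_of_pow_eq_one hpow
    rw [hgord, hm] at this
    exact Nat.dvd_of_mul_dvd_mul_right hm0 this
  obtain ⟨d, rfl⟩ := hdvd
  refine ⟨((g ^ d : Fˣ) : F), ?_⟩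
  rw [← Units.val_pow_eq_pow_val, ← pow_mul, mul_comm d n, he', Units.val_mk0]

theorem natCast_ne_zero_of_dvd_card_sub_one [Fintype F] (hn : n ∣ Fintype.card F - 1) : (n : F) ≠ 0 := by
  obtain ⟨m, hm⟩ := hn
  intro h0
  have h1 : ((Fintype.card F - 1 : ℕ) : F) = 0 := by rw [hm]; simp [h0]
  rw [Nat.cast_sub Fintype.card_pos, FiniteField.cast_card_eq_zero] at h1
  simp at h1

/-- A list of length `n` running through all the roots of a split separable `x ^ n - a` has no
repetitions. -/
theorem injective_of_range_eq_roots (hn0 : 0 < n) {ζ a b : F} (hζ : IsPrimitiveRoot ζ n)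
    (ha : a ≠ 0) (hb : b ^ n = a) {α : Fin n → F}
    (hα : Set.range α = {x : F | (X ^ n - C a).IsRoot x}) : Function.Injective α := by
  classical
  have himg : Finset.univ.image α = (nthRoots n a).toFinset := by
    ext x
    rw [Multiset.mem_toFinset, mem_nthRoots hn0]
    have := Set.ext_iff.mp hα x
    simpa [sub_eq_zero] using this
  have hcard : (Finset.univ.image α).card = n := by
    rw [himg, Multiset.toFinset_card_of_nodup (hζ.nthRoots_nodup ha), hζ.card_nthRoots,
      if_pos ⟨b, hb⟩]
  have := Finset.card_image_iff.mp (hcard.trans (Finset.card_fin n).symm)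
  exact Set.injOn_univ.mp (by simpa using this)

/-- Multiplication by `ζ` permutes the roots, so the sum is fixed by the factor `ζ ^ j ≠ 1`. -/
theorem sum_pow_eq_zero_of_range_eq_roots {ζ a : F} (hζ : IsPrimitiveRoot ζ n)
    {α : Fin n → F} (hinj : Function.Injective α)
    (hα : Set.range α = {x : F | (X ^ n - C a).IsRoot x}) {j : ℕ} (hj0 : 0 < j) (hj : j < n) :
    ∑ i, α i ^ j = 0 := by
  classical
  have hmem (x : F) : x ∈ Finset.univ.image α ↔ x ^ n = a := by
    simpa [sub_eq_zero] using Set.ext_iff.mp hα x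
  have hsum : ∑ i, α i ^ j = ∑ x ∈ Finset.univ.image α, x ^ j :=
    (Finset.sum_image (f := fun x : F => x ^ j) (hinj.injOn)).symm
  have hζ0 : ζ ≠ 0 := hζ.ne_zero (by omega)
  have hinv : ∑ x ∈ Finset.univ.image α, x ^ j
      = ∑ x ∈ Finset.univ.image α, (ζ * x) ^ j := by
    symm
    refine Finset.sum_bij' (fun x _ => ζ * x) (fun x _ => ζ⁻¹ * x) ?_ ?_ ?_ ?_ ?_
    · intro x hx
      rw [hmem] at hx ⊢
      rw [mul_pow, hζ.pow_eq_one, one_mul, hx]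
    · intro x hx
      rw [hmem] at hx ⊢
      rw [mul_pow, inv_pow, hζ.pow_eq_one, inv_one, one_mul, hx]
    · intro x _
      exact inv_mul_cancel_left₀ hζ0 x
    · intro x _
      exact mul_inv_cancel_left₀ hζ0 x
    · intro x _
      rfl
  simp_rw [mul_pow, ← Finset.mul_sum] at hinv
  have hne : ζ ^ j ≠ 1 := hζ.pow_ne_one_of_pos_of_lt hj0.ne' hj
  rw [hsum]
  by_contra hS
  exact hne (mul_right_cancel₀ hS (by rw [one_mul, ← hinv]))

theorem sum_eval_of_range_eq_roots {ζ a : F} (hζ : IsPrimitiveRoot ζ n)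
    {α : Fin n → F} (hinj : Function.Injective α)
    (hα : Set.range α = {x : F | (X ^ n - C a).IsRoot x}) {p : F[X]} (hp : p.natDegree < n) :
    ∑ i, p.eval (α i) = n * p.eval 0 := by
  simp_rw [eval_eq_sum_range' hp]
  rw [Finset.sum_comm]
  simp_rw [← Finset.mul_sum]
  rw [Finset.mul_sum]
  refine Finset.sum_congr rfl fun j hj => ?_
  rcases Nat.eq_zero_or_pos j with rfl | hj0
  · simp [mul_comm]
  · rw [sum_pow_eq_zero_of_range_eq_roots hζ hinj hα hj0 (Finset.mem_range.mp hj),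
      zero_pow hj0.ne', mul_zero, mul_zero]

end RootsOfXPowSub

/-! ### Interpolation by twisted polynomials. -/

section Twisted

variable {F : Type*} [Field F] {n k l : ℕ}

theorem natDegree_twistedPoly_le (h : Fin k) (η : Fin (l + 1) → F) (f : Fin k → F) :
    (twistedPoly h η f).natDegree ≤ k + l := by
  refine natDegree_add_le_of_degree_le ?_ ?_
  · refine natDegree_sum_le_of_forall_le _ _ fun i _ => (natDegree_C_mul_X_pow_le _ _).trans ?_
    omega
  · refine (natDegree_C_mul_le _ _).trans ?_
    refine natDegree_sum_le_of_forall_le _ _ fun t _ => (natDegree_C_mul_X_pow_le _ _).trans ?_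
    omega

/-- `twistedPoly` as a linear map in the coefficient vector. -/
noncomputable def twistedPolyLinear (h : Fin k) (η : Fin (l + 1) → F) : (Fin k → F) →ₗ[F] F[X] where
  toFun := twistedPoly h η
  map_add' f g := by
    simp only [twistedPoly, Pi.add_apply, C_add, add_mul, Finset.sum_add_distrib]
    ring
  map_smul' a f := by
    simp only [twistedPoly, Pi.smul_apply, smul_eq_mul, C_mul, mul_assoc, ← Finset.mul_sum,
      RingHom.id_apply, smul_eq_C_mul, mul_add]

/-- A polynomial in `x` with `f 0 = 0` splits off a factor `x`, and the remaining hook is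
`hookPoly`. -/
theorem exists_twistedPoly_eq_X_mul {h : Fin k} (hh : 1 ≤ (h : ℕ)) (η : Fin (l + 1) → F)
    {f : Fin k → F} (h0 : (twistedPoly h η f).eval 0 = 0) :
    ∃ p : F[X], p.degree < ((k - 1 : ℕ) : WithBot ℕ) ∧ p.coeff ((h : ℕ) - 1) = 0 ∧
      twistedPoly h η f = X * (p + C (f h) * hookPoly h η) := by
  classical
  -- The hook monomial is moved into `hookPoly`, so `P` has no `X ^ h` term.
  let P : F[X] := ∑ i : Fin k, C (Function.update f h 0 i) * X ^ (i : ℕ)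
  have hP : ∑ i : Fin k, C (f i) * X ^ (i : ℕ) = P + C (f h) * X ^ (h : ℕ) := by
    have hsingle : C (f h) * X ^ (h : ℕ) =
        ∑ i : Fin k, C ((Pi.single h (f h) : Fin k → F) i) * X ^ (i : ℕ) := by
      rw [Finset.sum_eq_single h (fun i _ hi => by simp [Pi.single_eq_of_ne hi]) (by simp),
        Pi.single_eq_same]
    rw [hsingle, ← Finset.sum_add_distrib]
    refine Finset.sum_congr rfl fun i _ => ?_
    rcases eq_or_ne i h with rfl | hi
    · simp
    · simp [hi]
  have hX : hookPoly h η * X = X ^ (h : ℕ) + ∑ t : Fin (l + 1), C (η t) * X ^ (k + (t : ℕ)) := by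
    rw [hookPoly, add_mul, Finset.sum_mul, ← pow_succ, Nat.sub_add_cancel hh]
    congr 1
    refine Finset.sum_congr rfl fun t _ => ?_
    rw [mul_assoc, ← pow_succ, Nat.sub_add_cancel (by omega)]
  have hF : twistedPoly h η f = P + C (f h) * (hookPoly h η * X) := by
    rw [hX, twistedPoly, hP]
    ring
  have hP0 : P.coeff 0 = 0 := by
    rw [hF] at h0
    simpa [← coeff_zero_eq_eval_zero] using h0
  refine ⟨P.divX, ?_, ?_, ?_⟩
  · rw [degree_lt_iff_coeff_zero]
    intro m hm
    rw [coeff_divX, finsetSum_coeff]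
    refine Finset.sum_eq_zero fun i _ => ?_
    rw [coeff_C_mul_X_pow, if_neg (by omega)]
  · rw [coeff_divX, Nat.sub_add_cancel hh, finsetSum_coeff]
    refine Finset.sum_eq_zero fun i _ => ?_
    rw [coeff_C_mul_X_pow]
    split_ifs with hi
    · rw [← Fin.ext hi, Function.update_self]
    · rfl
  · have := P.divX_mul_X_add
    rw [hP0, C_0, add_zero] at this
    rw [hF]
    nth_rewrite 1 [← this]
    ring

theorem headPoly_monic (k : ℕ) (α : Fin n → F) : (headPoly k α).Monic :=
  monic_prod_of_monic _ _ fun i _ => monic_X_sub_C (α i)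

theorem card_headIndices (hkn : k ≤ n) :
    (Finset.univ.filter fun i : Fin n => (i : ℕ) + 1 ≤ k - 1).card = k - 1 := by
  have := Fin.card_filter_val_lt (n := n) (m := k - 1)
  simpa only [Nat.add_one_le_iff, min_eq_right (show k - 1 ≤ n by omega)] using this

theorem degree_headPoly (hkn : k ≤ n) (α : Fin n → F) :
    (headPoly k α).degree = ((k - 1 : ℕ) : WithBot ℕ) := by
  rw [headPoly, degree_prod]
  simp only [degree_X_sub_C, Finset.sum_const, card_headIndices hkn, nsmul_one]

theorem headPoly_dvd {α : Fin n → F} (hinj : Function.Injective α) {p : F[X]}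
    (hp : ∀ i : Fin n, (i : ℕ) + 1 ≤ k - 1 → p.eval (α i) = 0) : headPoly k α ∣ p := by
  refine Finset.prod_dvd_of_coprime ?_ fun i hi => ?_
  · intro i _ j _ hij
    exact pairwise_coprime_X_sub_C hinj hij
  · exact dvd_iff_isRoot.mpr (hp i (by simpa using hi))

/-- The points `0, α₁, …, α_{k-1}` determine a twisted polynomial when the hook remainder does
not vanish. -/
theorem twistedPoly_eq_zero_of_eval_eq_zero (hkn : k ≤ n) {h : Fin k} (hh : 1 ≤ (h : ℕ))
    (η : Fin (l + 1) → F) {α : Fin n → F} (hinj : Function.Injective α) (hα0 : ∀ i, α i ≠ 0)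
    (hr : ((hookPoly h η) %ₘ (headPoly k α)).coeff ((h : ℕ) - 1) ≠ 0)
    {f : Fin k → F} (h0 : (twistedPoly h η f).eval 0 = 0)
    (hf : ∀ i : Fin n, (i : ℕ) + 1 ≤ k - 1 → (twistedPoly h η f).eval (α i) = 0) :
    twistedPoly h η f = 0 := by
  obtain ⟨p, hdeg, hcoeff, heq⟩ := exists_twistedPoly_eq_X_mul hh η h0
  have hdvd : headPoly k α ∣ p + C (f h) * hookPoly h η := by
    refine headPoly_dvd hinj fun i hi => ?_
    have := hf i hi
    rw [heq, eval_mul, eval_X] at this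
    exact (mul_eq_zero.mp this).resolve_left (hα0 i)
  have hmod := (modByMonic_eq_zero_iff_dvd (headPoly_monic k α)).mpr hdvd
  -- `p` is its own remainder and has no coefficient at `h - 1`, so that coefficient of `hmod` reads
  -- `f h * r = 0` with `r ≠ 0`.
  have hpmod : p %ₘ headPoly k α = p :=
    (modByMonic_eq_self_iff (headPoly_monic k α)).mpr (by rwa [degree_headPoly hkn])
  rw [add_modByMonic, hpmod, ← smul_eq_C_mul, smul_modByMonic] at hmod
  have hfh : f h = 0 := by
    have := congrArg (fun q : F[X] => q.coeff ((h : ℕ) - 1)) hmod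
    simp only [coeff_add, hcoeff, coeff_smul, smul_eq_mul, zero_add, coeff_zero] at this
    exact (mul_eq_zero.mp this).resolve_right hr
  rw [hfh, zero_smul, add_zero] at hmod
  rw [heq, hmod, hfh, C_0, zero_mul, add_zero, mul_zero]

theorem eq_zero_of_twistedPoly_eq_zero {h : Fin k} {η : Fin (l + 1) → F} {f : Fin k → F}
    (hf : twistedPoly h η f = 0) : f = 0 := by
  funext j
  have := congrArg (fun q : F[X] => q.coeff (j : ℕ)) hf
  simp only [twistedPoly, coeff_add, finsetSum_coeff, coeff_C_mul, coeff_X_pow, coeff_zero] at this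
  have hz : ∀ t : Fin (l + 1), (if (j : ℕ) = k + (t : ℕ) then (1 : F) else 0) = 0 :=
    fun t => if_neg (by omega)
  simpa [hz, Fin.val_inj] using this

/-- Evaluation of twisted polynomials at `0, α₁, …, α_{k-1}`. -/
noncomputable def headEval (h : Fin k) (η : Fin (l + 1) → F) (α : Fin n → F) :
    (Fin k → F) →ₗ[F] F × ({i : Fin n // (i : ℕ) + 1 ≤ k - 1} → F) :=
  ((leval 0).prod (LinearMap.pi fun i => leval (α i.1))).comp (twistedPolyLinear h η)

/-- Both sides have dimension `k`, so injectivity suffices. -/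
theorem headEval_surjective (hkn : k ≤ n) {h : Fin k} (hh : 1 ≤ (h : ℕ))
    (η : Fin (l + 1) → F) {α : Fin n → F} (hinj : Function.Injective α) (hα0 : ∀ i, α i ≠ 0)
    (hr : ((hookPoly h η) %ₘ (headPoly k α)).coeff ((h : ℕ) - 1) ≠ 0) :
    Function.Surjective (headEval h η α) := by
  have hrank : Module.finrank F (Fin k → F) =
      Module.finrank F (F × ({i : Fin n // (i : ℕ) + 1 ≤ k - 1} → F)) := by
    rw [Module.finrank_prod, Module.finrank_self, Module.finrank_fin_fun,
      Module.finrank_fintype_fun_eq_card, Fintype.card_subtype, card_headIndices hkn]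
    omega
  refine (LinearMap.injective_iff_surjective_of_finrank_eq_finrank hrank).mp ?_
  rw [injective_iff_map_eq_zero]
  intro f hf
  rw [Prod.ext_iff] at hf
  refine eq_zero_of_twistedPoly_eq_zero (h := h) (η := η)
    (twistedPoly_eq_zero_of_eval_eq_zero hkn hh η hinj hα0 hr hf.1 fun i hi => ?_)
  exact congrFun hf.2 ⟨i, hi⟩

end Twisted

theorem mainTheorem1 {F : Type*} [Field F] [Fintype F] (n k l : ℕ)
    (hk : 2 ≤ k) (hkn : 2 * k + 2 * l + 1 ≤ n)
    (hn : n ∣ Fintype.card F - 1)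
    (lam : F) (hlam : lam ≠ 0) (hord : orderOf lam ∣ (Fintype.card F - 1) / n)
    (h : Fin k) (hh : 1 ≤ (h : ℕ)) (η : Fin (l + 1) → F)
    (α v : Fin n → F)
    (hα : Set.range α = {x : F | (Polynomial.X ^ n - Polynomial.C lam).IsRoot x})
    (hv_tail : ∀ i : Fin n, k ≤ (i : ℕ) + 1 → v i = 1 ∨ v i = -1)
    (hv_head : ∀ i : Fin n, (i : ℕ) + 1 ≤ k - 1 → v i ≠ -1 ∧ v i ≠ 0 ∧ v i ≠ 1)
    (hr : ((hookPoly h η) %ₘ (headPoly k α)).coeff ((h : ℕ) - 1) ≠ 0) :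
    Function.Injective α ∧ IsLCD (tgrsCode α v h η) := by
  classical
  obtain ⟨ζ, hζ⟩ := exists_isPrimitiveRoot_of_dvd_card_sub_one hn
  obtain ⟨b, hb⟩ := exists_pow_eq_of_orderOf_dvd hn hlam hord
  have hn0 : 0 < n := by omega
  have hinj := injective_of_range_eq_roots hn0 hζ hlam hb hα
  have hα0 (i : Fin n) : α i ≠ 0 := by
    intro hi
    have : α i ∈ {x : F | (X ^ n - C lam).IsRoot x} := hα ▸ Set.mem_range_self i
    rw [hi] at this
    simp [hn0.ne', hlam] at this
  have hsurj := headEval_surjective (by omega) hh η hinj hα0 hr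
  refine ⟨hinj, (Submodule.eq_bot_iff _).mpr ?_⟩
  rintro _ ⟨⟨f, rfl⟩, hdual⟩
  have key (g : Fin k → F) : n * ((twistedPoly h η f).eval 0 * (twistedPoly h η g).eval 0) +
      ∑ i : {i : Fin n // (i : ℕ) + 1 ≤ k - 1}, (v i ^ 2 - 1) *
        ((twistedPoly h η f).eval (α i) * (twistedPoly h η g).eval (α i)) = 0 := by
    have hdeg : (twistedPoly h η f * twistedPoly h η g).natDegree < n := by
      have h1 := natDegree_twistedPoly_le h η f
      have h2 := natDegree_twistedPoly_le h η g
      have h3 := natDegree_mul_le (p := twistedPoly h η f) (q := twistedPoly h η g)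
      omega
    have hsum := sum_eval_of_range_eq_roots hζ hinj hα hdeg
    simp only [eval_mul] at hsum
    have hd : ∑ i, (v i * (twistedPoly h η f).eval (α i)) *
        (v i * (twistedPoly h η g).eval (α i)) = 0 := hdual _ ⟨g, rfl⟩
    -- Termwise this is `1 + (v i ^ 2 - 1) = v i ^ 2`, where the correction is zero on the tail.
    rw [← hsum, ← hd, ← Finset.sum_subtype (Finset.univ.filter fun i : Fin n => (i : ℕ) + 1 ≤ k - 1)
      (by simp) (fun i => (v i ^ 2 - 1) *
        ((twistedPoly h η f).eval (α i) * (twistedPoly h η g).eval (α i))),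
      Finset.sum_filter, ← Finset.sum_add_distrib]
    refine Finset.sum_congr rfl fun i _ => ?_
    split_ifs with hi
    · ring
    · rcases hv_tail i (by omega) with hv | hv <;> rw [hv] <;> ring
  have hf0 : (twistedPoly h η f).eval 0 = 0 := by
    obtain ⟨g, hg⟩ := hsurj (1, 0)
    rw [Prod.ext_iff] at hg
    have hg1 : (twistedPoly h η g).eval 0 = 1 := hg.1
    have hg2 (i : {i : Fin n // (i : ℕ) + 1 ≤ k - 1}) : (twistedPoly h η g).eval (α i) = 0 :=
      congrFun hg.2 i
    simpa [hg1, hg2, natCast_ne_zero_of_dvd_card_sub_one hn] using key g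
  have hfα (j : Fin n) (hj : (j : ℕ) + 1 ≤ k - 1) : (twistedPoly h η f).eval (α j) = 0 := by
    obtain ⟨g, hg⟩ := hsurj (0, Pi.single ⟨j, hj⟩ 1)
    rw [Prod.ext_iff] at hg
    have hg2 (i : {i : Fin n // (i : ℕ) + 1 ≤ k - 1}) :
        (twistedPoly h η g).eval (α i) = (Pi.single ⟨j, hj⟩ 1 : _ → F) i := congrFun hg.2 i
    have hkey := key g
    simp only [hf0, hg2, zero_mul, mul_zero, zero_add] at hkey
    rw [Finset.sum_eq_single ⟨j, hj⟩ (fun i _ hi => by rw [Pi.single_eq_of_ne hi]; ring)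
      (by simp), Pi.single_eq_same, mul_one] at hkey
    refine (mul_eq_zero.mp hkey).resolve_left fun hv => ?_
    obtain ⟨hv1, -, hv2⟩ := hv_head j hj
    rcases sq_eq_one_iff.mp (sub_eq_zero.mp hv) with hv | hv
    · exact hv2 hv
    · exact hv1 hv
  have hzero := twistedPoly_eq_zero_of_eval_eq_zero (by omega) hh η hinj hα0 hr hf0 hfα
  funext i
  simp [hzero]
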